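/- Let $S=[m]\times[n]$ be the set of positions of an $m\times n$ matrix, and for $x\in\mathbb R^{S}$ and $Z\subseteq S$ write $\tilde x(Z)=\sum_{s\in Z}x(s)$. For $(i,j)\in S$ let $P^1_{i,j}$ be the set of the first $j$ positions of row $i$ (a horizontal prefix) and $P^2_{i,j}$ the set of the first $i$ positions of column $j$ (a vertical prefix). Let $\Phi^1,\Phi^2:S\to\mathbb Z\cup\{-\infty\}$ and $\Gamma^1,\Gamma^2:S\to\mathbb Z\cup\{+\infty\}$ with $\Phi^1\le\Gamma^1$ and $\Phi^2\le\Gamma^2$. A prefix-bounded matrix (PBM) is an integer matrix $A\in\mathbb Z^{S}$ with $\Phi^k(i,j)\le\tilde A(P^k_{i,j})\le\Gamma^k(i,j)$ for all $(i,j)\in S$ and $k=1,2$. For $k=1,2$ put $$Q^k=\{x\in\mathbb R^{S}:\Phi^k(i,j)\le\tilde x(P^k_{i,j})\le\Gamma^k(i,j)\text{ for every }(i,j)\in S\}.$$ Definitions. All set functions vanish on $\emptyset$. For set functions $p$ (values in $\mathbb Z\cup\{-\infty\}$) and $b$ (values in $\mathbb Z\cup\{+\infty\}$) on a finite ground set,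 let $Q(p,b)=\{x:p(Z)\le\tilde x(Z)\le b(Z)\text{ for every }Z\}$. A g-polymatroid is the empty set or a polyhedron $Q(p,b)$ for which $p$ is supermodular, $b$ is submodular and $b(X)-p(Y)\ge b(X\setminus Y)-p(Y\setminus X)$ for all $X,Y$. It is laminar if it can be written as $Q(p,b)$ with functions $p,b$ (not necessarily satisfying the preceding conditions) that, apart from $\emptyset$, are finite only on members of a laminar family of non-empty sets. For a totally ordered set $u_1,\dots,u_t$ and functions $\varphi\le\gamma$ on it ($\varphi$ with values in $\mathbb Z\cup\{-\infty\}$, $\gamma$ with values in $\mathbb Z\cup\{+\infty\}$), the elementary prefix-bounded g-polymatroid is $Q(p_\varphi,b_\gamma)$, where $p_\varphi(\{u_1,\dots,u_k\})=\varphi(u_k)$, $b_\gamma(\{u_1,\dots,u_k\})=\gamma(u_k)$, and $p_\varphi=-\infty$, $b_\gamma=+\infty$ on all other non-empty sets; direct sums of these are called prefix-bounded. A polyhedron is integral if it is the convex hull of its integer points. A set of integer vectors is $M^\natural_2$-convex if it is the set of integer points of the intersection of two integral g-polymatroids. Then the following hold. 1. $Q^1$ is the direct sum, over the rows, of the elementary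 prefix-bounded g-polymatroids defined by the rows of $\Phi^1,\Gamma^1$; $Q^2$ is the direct sum, over the columns, of those defined by the columns of $\Phi^2,\Gamma^2$; and $Q^1$ and $Q^2$ are laminar g-polymatroids. 2. The convex hull of the prefix-bounded matrices is $Q^1\cap Q^2$. In particular, the set of prefix-bounded matrices is $M^\natural_2$-convex. 3. Let moreover $f:S\to\mathbb Z\cup\{-\infty\}$ and $g:S\to\mathbb Z\cup\{+\infty\}$ with $f\le g$, and $\alpha\in\mathbb Z\cup\{-\infty\}$, $\beta\in\mathbb Z\cup\{+\infty\}$ with $\alpha\le\beta$. The convex hull of the prefix-bounded matrices $A$ with $f\le A\le g$ and $\alpha\le\tilde A(S)\le\beta$ is $$Q^1\cap Q^2\cap\{x\in\mathbb R^{S}:f\le x\le g,\ \alpha\le\tilde x(S)\le\beta\}.$$ -/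

import Mathlib

namespace PrefixBounded

/-- A lower bound, an integer or `-∞`, as an extended real number. -/
noncomputable def lo : WithBot ℤ → EReal
  | ⊥ => ⊥
  | (a : ℤ) => ((a : ℝ) : EReal)

/-- An upper bound, an integer or `+∞`, as an extended real number. -/
noncomputable def up : WithTop ℤ → EReal
  | ⊤ => ⊤
  | (a : ℤ) => ((a : ℝ) : EReal)

/-! ### Generalized polymatroids on a ground set `S` -/

section GPolymatroid

variable {S : Type*}

/-- The polyhedron `Q(p,b) = {x ∈ ℝ^S : p(Z) ≤ x(Z) ≤ b(Z) for every Z ⊆ S}`, where `x(Z)` is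
the sum of the components of `x` over `Z`. -/
def gPoly (p : Finset S → WithBot ℤ) (b : Finset S → WithTop ℤ) : Set (S → ℝ) :=
  {x | ∀ Z : Finset S, lo (p Z) ≤ ((∑ s ∈ Z, x s : ℝ) : EReal) ∧
    ((∑ s ∈ Z, x s : ℝ) : EReal) ≤ up (b Z)}

/-- Strongly paramodular pairs of integer-valued set functions (`p` may take the value `-∞` and
`b` the value `+∞`). In the cross-inequality `b` is never `-∞` and `p` is never `+∞`, so
the differences of extended reals are well defined. -/
structure IsStrongPair [DecidableEq S] (p : Finset S → WithBot ℤ) (b : Finset S → WithTop ℤ) :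
    Prop where
  p_empty : p ∅ = 0
  b_empty : b ∅ = 0
  supermodular : ∀ X Y : Finset S, p X + p Y ≤ p (X ∩ Y) + p (X ∪ Y)
  submodular : ∀ X Y : Finset S, b (X ∩ Y) + b (X ∪ Y) ≤ b X + b Y
  cross : ∀ X Y : Finset S, up (b (X \ Y)) - lo (p (Y \ X)) ≤ up (b X) - lo (p Y)

/-- Generalized polymatroids with integral borders: the empty set, and the polyhedra bordered by
an integer-valued strong pair. -/
def IsGPolymatroid [DecidableEq S] (Q : Set (S → ℝ)) : Prop :=
  Q = ∅ ∨ ∃ (p : Finset S → WithBot ℤ) (b : Finset S → WithTop ℤ),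
    IsStrongPair p b ∧ Q = gPoly p b

/-- A laminar family of sets: no two members properly intersect. -/
def IsLaminar [DecidableEq S] (L : Set (Finset S)) : Prop :=
  ∀ X ∈ L, ∀ Y ∈ L,
    ¬ ((X \ Y).Nonempty ∧ (Y \ X).Nonempty ∧ (X ∩ Y).Nonempty)

/-- A laminar g-polymatroid: a g-polymatroid that is of the form `Q(p,b)` where, apart from the
empty set, `p` and `b` are finite only on members of a laminar family of non-empty sets. -/
def IsLaminarGPolymatroid [DecidableEq S] (Q : Set (S → ℝ)) : Prop :=
  IsGPolymatroid Q ∧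
    ∃ (L : Set (Finset S)) (p : Finset S → WithBot ℤ) (b : Finset S → WithTop ℤ),
      IsLaminar L ∧ (∀ Z ∈ L, Z.Nonempty) ∧ p ∅ = 0 ∧ b ∅ = 0 ∧
      (∀ Z : Finset S, Z.Nonempty → Z ∉ L → p Z = ⊥ ∧ b Z = ⊤) ∧
      Q = gPoly p b

/-- The real vector given by an integer vector. -/
def toReal (z : S → ℤ) : S → ℝ := fun s => (z s : ℝ)

/-- An integral polyhedron: the convex hull of its integer points. -/
def IsIntegral (Q : Set (S → ℝ)) : Prop :=
  convexHull ℝ (toReal '' {z : S → ℤ | toReal z ∈ Q}) = Q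

/-- `M♮₂`-convex sets: the sets of integer points of the intersection of two integral
g-polymatroids. -/
def IsM2NaturalConvex [DecidableEq S] (B : Set (S → ℤ)) : Prop :=
  ∃ Q₁ Q₂ : Set (S → ℝ),
    IsGPolymatroid Q₁ ∧ IsIntegral Q₁ ∧ IsGPolymatroid Q₂ ∧ IsIntegral Q₂ ∧
    B = {z : S → ℤ | toReal z ∈ Q₁ ∩ Q₂}

/-- The box `T(f,g) = {x : f ≤ x ≤ g}`. -/
def box (f : S → WithBot ℤ) (g : S → WithTop ℤ) : Set (S → ℝ) :=
  {x | ∀ s, lo (f s) ≤ (x s : EReal) ∧ (x s : EReal) ≤ up (g s)}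

/-- The plank `K(α,β) = {x : α ≤ x(S) ≤ β}`. -/
def plank [Fintype S] (α : WithBot ℤ) (β : WithTop ℤ) : Set (S → ℝ) :=
  {x | lo α ≤ ((∑ s, x s : ℝ) : EReal) ∧ ((∑ s, x s : ℝ) : EReal) ≤ up β}

end GPolymatroid

/-! ### Elementary prefix-bounded g-polymatroids on an ordered set of `t` elements -/

/-- The set function `p_φ`: its value is `φ k` on the set of the elements up to `k`, `0` on the
empty set, and `-∞` on all other sets. -/
def lowerSetFun {t : ℕ} (φ : Fin t → WithBot ℤ) (Z : Finset (Fin t)) : WithBot ℤ :=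
  if h : Z.Nonempty then
    if Z = Finset.Iic (Z.max' h) then φ (Z.max' h) else ⊥
  else 0

/-- The set function `b_γ`: its value is `γ k` on the set of the elements up to `k`, `0` on the
empty set, and `+∞` on all other sets. -/
def upperSetFun {t : ℕ} (γ : Fin t → WithTop ℤ) (Z : Finset (Fin t)) : WithTop ℤ :=
  if h : Z.Nonempty then
    if Z = Finset.Iic (Z.max' h) then γ (Z.max' h) else ⊤
  else 0

/-- The elementary prefix-bounded g-polymatroid `Q(p_φ, b_γ)`. -/
def elementary {t : ℕ} (φ : Fin t → WithBot ℤ) (γ : Fin t → WithTop ℤ) : Set (Fin t → ℝ) :=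
  gPoly (lowerSetFun φ) (upperSetFun γ)

/-! ### Matrices

An `m × n` matrix is a function on the set `Fin m × Fin n` of its positions. -/

section Matrices

variable {m n : ℕ}

/-- The direct sum of polyhedra given on the rows. -/
def rowDirectSum (Q : Fin m → Set (Fin n → ℝ)) : Set (Fin m × Fin n → ℝ) :=
  {x | ∀ i, (fun j => x (i, j)) ∈ Q i}

/-- The direct sum of polyhedra given on the columns. -/
def colDirectSum (Q : Fin n → Set (Fin m → ℝ)) : Set (Fin m × Fin n → ℝ) :=
  {x | ∀ j, (fun i => x (i, j)) ∈ Q j}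

/-- The horizontal prefix ending at position `s = (i,j)`: the positions of row `i` up to
column `j`. -/
def hPre (s : Fin m × Fin n) : Finset (Fin m × Fin n) := {s.1} ×ˢ Finset.Iic s.2

/-- The vertical prefix ending at position `s = (i,j)`: the positions of column `j` up to
row `i`. -/
def vPre (s : Fin m × Fin n) : Finset (Fin m × Fin n) := Finset.Iic s.1 ×ˢ {s.2}

/-- `Q¹`: the real matrices whose horizontal prefix sums lie between `Φ` and `Γ`. -/
def hPoly (Φ : Fin m × Fin n → WithBot ℤ) (Γ : Fin m × Fin n → WithTop ℤ) :
    Set (Fin m × Fin n → ℝ) :=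
  {x | ∀ s, lo (Φ s) ≤ ((∑ u ∈ hPre s, x u : ℝ) : EReal) ∧
    ((∑ u ∈ hPre s, x u : ℝ) : EReal) ≤ up (Γ s)}

/-- `Q²`: the real matrices whose vertical prefix sums lie between `Φ` and `Γ`. -/
def vPoly (Φ : Fin m × Fin n → WithBot ℤ) (Γ : Fin m × Fin n → WithTop ℤ) :
    Set (Fin m × Fin n → ℝ) :=
  {x | ∀ s, lo (Φ s) ≤ ((∑ u ∈ vPre s, x u : ℝ) : EReal) ∧
    ((∑ u ∈ vPre s, x u : ℝ) : EReal) ≤ up (Γ s)}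

/-- The (integer) prefix-bounded matrices defined by the horizontal-prefix bounds `(Φ₁, Γ₁)` and
the vertical-prefix bounds `(Φ₂, Γ₂)`. -/
def pbm (Φ₁ : Fin m × Fin n → WithBot ℤ) (Γ₁ : Fin m × Fin n → WithTop ℤ)
    (Φ₂ : Fin m × Fin n → WithBot ℤ) (Γ₂ : Fin m × Fin n → WithTop ℤ) :
    Set (Fin m × Fin n → ℤ) :=
  {A | ∀ s,
    (Φ₁ s ≤ ((∑ u ∈ hPre s, A u : ℤ) : WithBot ℤ) ∧
      ((∑ u ∈ hPre s, A u : ℤ) : WithTop ℤ) ≤ Γ₁ s) ∧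
    (Φ₂ s ≤ ((∑ u ∈ vPre s, A u : ℤ) : WithBot ℤ) ∧
      ((∑ u ∈ vPre s, A u : ℤ) : WithTop ℤ) ≤ Γ₂ s)}

/-- The integer matrices with entries between `f` and `g` and total sum between `α` and `β`. -/
def bounded (f : Fin m × Fin n → WithBot ℤ) (g : Fin m × Fin n → WithTop ℤ)
    (α : WithBot ℤ) (β : WithTop ℤ) : Set (Fin m × Fin n → ℤ) :=
  {A | (∀ s, f s ≤ (A s : WithBot ℤ) ∧ (A s : WithTop ℤ) ≤ g s) ∧
    α ≤ ((∑ s, A s : ℤ) : WithBot ℤ) ∧ ((∑ s, A s : ℤ) : WithTop ℤ) ≤ β}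

end Matrices

end PrefixBounded

namespace PrefixBounded

section Circulation

variable {V E : Type*} [DecidableEq V] [Fintype E]

/-- Circulations on the digraph with arcs `E`, tails `src` and heads `dst`. -/
def IsCirculation {R : Type*} [AddCommMonoid R] (src dst : E → V) (x : E → R) : Prop :=
  ∀ v, ∑ e with src e = v, x e = ∑ e with dst e = v, x e

/-- The subgroup of integers in `ℝ`. -/
def integers : AddSubgroup ℝ := (Int.castAddHom ℝ).range

lemma mem_integers {r : ℝ} : r ∈ integers ↔ ∃ z : ℤ, (z : ℝ) = r := Iff.rfl

open Classical in
/-- The arcs with a fractional value. -/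
noncomputable def fracArcs (x : E → ℝ) : Finset E := {e | x e ∉ integers}

lemma mem_fracArcs {x : E → ℝ} {e : E} : e ∈ fracArcs x ↔ x e ∉ integers := by
  simp [fracArcs]

lemma IsCirculation.two_le_degree [DecidableEq E] {src dst : E → V} {x : E → ℝ}
    (hx : IsCirculation src dst x) {v : V}
    (hv : ∃ e ∈ fracArcs x, src e = v ∨ dst e = v) :
    2 ≤ ((fracArcs x).filter (src · = v)).card + ((fracArcs x).filter (dst · = v)).card := by
  have key : ∀ f : E → V, ∑ e with f e = v, x e - ∑ e ∈ (fracArcs x).filter (f · = v), x e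
      ∈ integers := by
    intro f
    have hsub : (fracArcs x).filter (f · = v) ⊆ Finset.univ.filter (f · = v) :=
      Finset.filter_subset_filter _ (Finset.subset_univ _)
    rw [← Finset.sum_sdiff hsub, add_sub_cancel_right]
    refine sum_mem fun e he => ?_
    by_contra hc
    simp only [Finset.mem_sdiff, Finset.mem_filter, Finset.mem_univ, true_and, not_and] at he
    exact he.2 (mem_fracArcs.2 hc) he.1
  have hdiff : ∑ e ∈ (fracArcs x).filter (src · = v), x e -
      ∑ e ∈ (fracArcs x).filter (dst · = v), x e ∈ integers := by
    have := sub_mem (key dst) (key src)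
    rw [hx v] at this
    convert this using 1
    ring
  by_contra hlt
  push Not at hlt
  have hpos : 1 ≤ ((fracArcs x).filter (src · = v)).card +
      ((fracArcs x).filter (dst · = v)).card := by
    obtain ⟨e, he, h | h⟩ := hv
    · have : 0 < ((fracArcs x).filter (src · = v)).card :=
        Finset.card_pos.2 ⟨e, Finset.mem_filter.2 ⟨he, h⟩⟩
      omega
    · have : 0 < ((fracArcs x).filter (dst · = v)).card :=
        Finset.card_pos.2 ⟨e, Finset.mem_filter.2 ⟨he, h⟩⟩
      omega
  have hcases : (((fracArcs x).filter (src · = v)).card = 1 ∧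
      ((fracArcs x).filter (dst · = v)).card = 0) ∨
      (((fracArcs x).filter (src · = v)).card = 0 ∧
      ((fracArcs x).filter (dst · = v)).card = 1) := by omega
  rcases hcases with ⟨h1, h0⟩ | ⟨h0, h1⟩
  · obtain ⟨e, he⟩ := Finset.card_eq_one.1 h1
    rw [Finset.card_eq_zero.1 h0, he] at hdiff
    have hm : e ∈ (fracArcs x).filter (src · = v) := by simp [he]
    exact mem_fracArcs.1 (Finset.mem_filter.1 hm).1 (by simpa using hdiff)
  · obtain ⟨e, he⟩ := Finset.card_eq_one.1 h1
    rw [Finset.card_eq_zero.1 h0, he] at hdiff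
    have hm : e ∈ (fracArcs x).filter (dst · = v) := by simp [he]
    exact mem_fracArcs.1 (Finset.mem_filter.1 hm).1 (by simpa using hdiff)

/-- A circulation with a fractional value can be perturbed on its fractional arcs. -/
lemma IsCirculation.exists_direction {src dst : E → V} {x : E → ℝ}
    (hx : IsCirculation src dst x) (hF : (fracArcs x).Nonempty) :
    ∃ d : E → ℝ, d ≠ 0 ∧ IsCirculation src dst d ∧ ∀ e ∉ fracArcs x, d e = 0 := by
  classical
  set F := fracArcs x with hFdef
  set W := F.image src ∪ F.image dst with hW
  have hsrc : ∀ e ∈ F, src e ∈ W := fun e he =>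
    Finset.mem_union_left _ (Finset.mem_image_of_mem _ he)
  have hdst : ∀ e ∈ F, dst e ∈ W := fun e he =>
    Finset.mem_union_right _ (Finset.mem_image_of_mem _ he)
  have hcard : W.card ≤ F.card := by
    have h1 : ∑ v ∈ W, 2 ≤ ∑ v ∈ W, ((F.filter (src · = v)).card + (F.filter (dst · = v)).card) := by
      refine Finset.sum_le_sum fun v hv => hx.two_le_degree ?_
      rcases Finset.mem_union.1 hv with h | h <;> obtain ⟨e, he, rfl⟩ := Finset.mem_image.1 h
      · exact ⟨e, he, Or.inl rfl⟩
      · exact ⟨e, he, Or.inr rfl⟩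
    rw [Finset.sum_add_distrib, ← Finset.card_eq_sum_card_fiberwise hsrc,
      ← Finset.card_eq_sum_card_fiberwise hdst, Finset.sum_const, smul_eq_mul] at h1
    omega
  let M : Matrix W F ℝ := fun w e =>
    (if src e = w then 1 else 0) - (if dst e = w then 1 else 0)
  have hcol : ∀ e : F, ∑ w : W, M w e = 0 := by
    intro e
    have h1 : ∑ w : W, (if src e = (w : V) then (1 : ℝ) else 0) = 1 := by
      rw [Finset.sum_eq_single (⟨src e, hsrc e e.2⟩ : W)]
      · simp
      · intro b _ hb
        rw [if_neg]
        intro h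
        exact hb (Subtype.ext h.symm)
      · simp
    have h2 : ∑ w : W, (if dst e = (w : V) then (1 : ℝ) else 0) = 1 := by
      rw [Finset.sum_eq_single (⟨dst e, hdst e e.2⟩ : W)]
      · simp
      · intro b _ hb
        rw [if_neg]
        intro h
        exact hb (Subtype.ext h.symm)
      · simp
    simp only [M, Finset.sum_sub_distrib, h1, h2, sub_self]
  have hinj : ¬ Function.Injective M.mulVecLin := by
    intro hinj
    have hfr : Module.finrank ℝ (F → ℝ) = Module.finrank ℝ (LinearMap.range M.mulVecLin) :=
      (LinearMap.finrank_range_of_inj hinj).symm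
    have hne : LinearMap.range M.mulVecLin ≠ ⊤ := by
      obtain ⟨e, he⟩ := hF
      intro htop
      have hm : (Pi.single (⟨src e, hsrc e he⟩ : W) 1 : W → ℝ) ∈ LinearMap.range M.mulVecLin := by
        rw [htop]; trivial
      obtain ⟨d, hd⟩ := hm
      have hs : ∑ w : W, M.mulVecLin d w = 0 := by
        simp only [Matrix.mulVecLin_apply, Matrix.mulVec, dotProduct]
        rw [Finset.sum_comm]
        refine Finset.sum_eq_zero fun e _ => ?_
        rw [← Finset.sum_mul, hcol, zero_mul]
      rw [hd] at hs
      simp at hs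
    have := Submodule.finrank_lt hne
    rw [← hfr] at this
    simp only [Module.finrank_fintype_fun_eq_card, Fintype.card_coe] at this
    omega
  obtain ⟨d, hd, hd0⟩ : ∃ d, M.mulVecLin d = 0 ∧ d ≠ 0 := by
    by_contra hcon
    push Not at hcon
    exact hinj ((injective_iff_map_eq_zero _).2 hcon)
  let D : E → ℝ := fun e => if h : e ∈ F then d ⟨e, h⟩ else 0
  have hDF : ∀ e : F, D e = d e := fun e => by simp [D]
  have hDsum : ∀ (f : E → V) v, ∑ e with f e = v, D e = ∑ e : F, if f e = v then d e else 0 := by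
    intro f v
    rw [Finset.sum_filter, ← Finset.sum_subset (Finset.subset_univ F), ← Finset.sum_coe_sort F]
    · simp only [hDF]
    · intro e _ he
      simp [D, he]
  refine ⟨D, ?_, ?_, ?_⟩
  · intro h
    apply hd0
    ext e
    rw [← hDF, h]
    rfl
  · intro v
    rw [hDsum, hDsum]
    by_cases hv : v ∈ W
    · have := congrFun hd ⟨v, hv⟩
      rw [Matrix.mulVecLin_apply] at this
      simp only [Matrix.mulVec, dotProduct, M, sub_mul, ite_mul, one_mul,
        zero_mul, Finset.sum_sub_distrib, Pi.zero_apply] at this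
      exact sub_eq_zero.1 this
    · rw [Finset.sum_eq_zero, Finset.sum_eq_zero]
      · intro e _
        exact if_neg fun h : dst e = v => hv (h ▸ hdst e e.2)
      · intro e _
        exact if_neg fun h : src e = v => hv (h ▸ hsrc e e.2)
  · intro e he
    simp [D, he]

lemma IsCirculation.add_smul {src dst : E → V} {x d : E → ℝ} (hx : IsCirculation src dst x)
    (hd : IsCirculation src dst d) (ε : ℝ) : IsCirculation src dst (x + ε • d) := by
  intro v
  simp only [Pi.add_apply, Pi.smul_apply, smul_eq_mul, Finset.sum_add_distrib, ← Finset.mul_sum,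
    hx v, hd v]

/-- Moving along a direction supported on the fractional arcs until an arc becomes integral. -/
lemma exists_step {x d : E → ℝ} (hd0 : d ≠ 0) (hd : ∀ e ∉ fracArcs x, d e = 0) :
    ∃ ε : ℝ, 0 < ε ∧ (∀ e, (⌊x e⌋ : ℝ) ≤ (x + ε • d) e ∧ (x + ε • d) e ≤ ⌈x e⌉) ∧
      (fracArcs (x + ε • d)).card < (fracArcs x).card := by
  classical
  let D : Finset E := {e | d e ≠ 0}
  have hD : D.Nonempty := by
    obtain ⟨e, he⟩ := Function.ne_iff.1 hd0
    exact ⟨e, by simpa [D] using he⟩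
  let t : E → ℝ := fun e => if 0 < d e then (⌈x e⌉ - x e) / d e else (x e - ⌊x e⌋) / (- d e)
  have hmemF : ∀ e ∈ D, e ∈ fracArcs x := by
    intro e he
    by_contra h
    exact (Finset.mem_filter.1 he).2 (hd e h)
  have hfl : ∀ e ∈ D, (⌊x e⌋ : ℝ) < x e := by
    intro e he
    refine lt_of_le_of_ne (Int.floor_le _) fun h => mem_fracArcs.1 (hmemF e he) ⟨_, h⟩
  have hce : ∀ e ∈ D, x e < (⌈x e⌉ : ℝ) := by
    intro e he
    refine lt_of_le_of_ne (Int.le_ceil _) fun h => mem_fracArcs.1 (hmemF e he) ⟨_, h.symm⟩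
  obtain ⟨e₀, he₀, hmin⟩ := D.exists_min_image t hD
  have htpos : ∀ e ∈ D, 0 < t e := by
    intro e he
    have hne := (Finset.mem_filter.1 he).2
    by_cases h : 0 < d e
    · simp only [t, if_pos h]
      exact div_pos (sub_pos.2 (hce e he)) h
    · simp only [t, if_neg h]
      exact div_pos (sub_pos.2 (hfl e he)) (neg_pos.2 (lt_of_le_of_ne (not_lt.1 h) hne))
  refine ⟨t e₀, htpos e₀ he₀, fun e => ?_, ?_⟩
  · simp only [Pi.add_apply, Pi.smul_apply, smul_eq_mul]
    by_cases hde : d e = 0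
    · simp only [hde, mul_zero, add_zero]
      exact ⟨Int.floor_le _, Int.le_ceil _⟩
    · have heD : e ∈ D := by simp [D, hde]
      have hle := hmin e heD
      have h0 := htpos e₀ he₀
      have h1 := hfl e heD
      have h2 := hce e heD
      by_cases h : 0 < d e
      · rw [show t e = (⌈x e⌉ - x e) / d e from if_pos h, le_div_iff₀ h] at hle
        have := mul_pos h0 h
        constructor <;> linarith
      · have hn : 0 < - d e := neg_pos.2 (lt_of_le_of_ne (not_lt.1 h) hde)
        rw [show t e = (x e - ⌊x e⌋) / (- d e) from if_neg h, le_div_iff₀ hn] at hle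
        have := mul_pos h0 hn
        constructor <;> linarith
  · refine Finset.card_lt_card (Finset.ssubset_iff_subset_ne.2 ⟨fun e he => ?_, fun h => ?_⟩)
    · by_contra hc
      rw [mem_fracArcs] at he
      apply he
      simp only [Pi.add_apply, Pi.smul_apply, hd e hc, smul_zero, add_zero]
      by_contra h
      exact hc (mem_fracArcs.2 h)
    · have := hmemF e₀ he₀
      rw [← h, mem_fracArcs] at this
      apply this
      have hne := (Finset.mem_filter.1 he₀).2
      simp only [Pi.add_apply, Pi.smul_apply, smul_eq_mul]
      by_cases hp : 0 < d e₀
      · refine mem_integers.2 ⟨⌈x e₀⌉, ?_⟩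
        rw [show t e₀ = (⌈x e₀⌉ - x e₀) / d e₀ from if_pos hp, div_mul_cancel₀ _ hne]
        ring
      · refine mem_integers.2 ⟨⌊x e₀⌋, ?_⟩
        rw [show t e₀ = (x e₀ - ⌊x e₀⌋) / (- d e₀) from if_neg hp]
        field_simp
        ring

/-- Every real circulation is a convex combination of integral roundings that are
circulations. -/
theorem IsCirculation.mem_convexHull {src dst : E → V} {x : E → ℝ}
    (hx : IsCirculation src dst x) :
    x ∈ convexHull ℝ (toReal '' {y : E → ℤ | IsCirculation src dst y ∧
      ∀ e, ⌊x e⌋ ≤ y e ∧ y e ≤ ⌈x e⌉}) := by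
  induction hN : (fracArcs x).card using Nat.strong_induction_on generalizing x with
  | _ N ih =>
  rcases (fracArcs x).eq_empty_or_nonempty with h0 | hF
  · have hint : ∀ e, ∃ z : ℤ, (z : ℝ) = x e := by
      intro e
      by_contra h
      have : e ∈ fracArcs x := mem_fracArcs.2 h
      simp [h0] at this
    choose y hy using hint
    refine subset_convexHull _ _ ⟨y, ⟨fun v => ?_, fun e => ?_⟩, funext hy⟩
    · have := hx v
      simp only [← hy] at this
      exact_mod_cast this
    · simp [← hy]
  · obtain ⟨d, hd0, hdc, hd⟩ := hx.exists_direction hF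
    have hull : ∀ ε : ℝ, (∀ e, (⌊x e⌋ : ℝ) ≤ (x + ε • d) e ∧ (x + ε • d) e ≤ ⌈x e⌉) →
        (fracArcs (x + ε • d)).card < (fracArcs x).card →
        x + ε • d ∈ convexHull ℝ (toReal '' {y : E → ℤ | IsCirculation src dst y ∧
          ∀ e, ⌊x e⌋ ≤ y e ∧ y e ≤ ⌈x e⌉}) := by
      intro ε hb hc
      refine convexHull_mono (Set.image_mono ?_) (ih _ (hN ▸ hc) (hx.add_smul hdc ε) rfl)
      rintro y ⟨hy, hyb⟩
      exact ⟨hy, fun e => ⟨(Int.le_floor.2 (hb e).1).trans (hyb e).1,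
        (hyb e).2.trans (Int.ceil_le.2 (hb e).2)⟩⟩
    obtain ⟨ε, hε, hb, hc⟩ := exists_step hd0 hd
    obtain ⟨δ, hδ, hb', hc'⟩ := exists_step (x := x) (d := -d) (neg_ne_zero.2 hd0)
      (fun e he => by simp [hd e he])
    rw [smul_neg, ← neg_smul] at hb' hc'
    have hs := (convex_convexHull ℝ _) (hull ε hb hc) (hull (-δ) hb' hc')
      (div_nonneg hδ.le (add_pos hε hδ).le) (div_nonneg hε.le (add_pos hε hδ).le)
      (by field_simp; ring)
    convert hs using 1
    ext e
    simp only [Pi.add_apply, Pi.smul_apply, smul_eq_mul]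
    have := (add_pos hε hδ).ne'
    field_simp
    ring

end Circulation
/-- The polyhedron of the real vectors whose prefix sums lie between `Φ` and `Γ`. -/
def prefixPoly {S : Type*} (pre : S → Finset S) (Φ : S → WithBot ℤ) (Γ : S → WithTop ℤ) : Set (S → ℝ) :=
  {x | ∀ s, lo (Φ s) ≤ ((∑ u ∈ pre s, x u : ℝ) : EReal) ∧
    ((∑ u ∈ pre s, x u : ℝ) : EReal) ≤ up (Γ s)}

section PrefixSystem

variable {S : Type*} [Fintype S] [DecidableEq S]

/-- A system of prefixes `pre s`, one for each element, where `next s` is the successor of `s`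
in its chain, if there is one. -/
structure IsPrefixSystem (pre : S → Finset S) (next : S → Option S) : Prop where
  self_mem : ∀ s, s ∈ pre s
  next_mem : ∀ s t, (next t).any (· ∈ pre s) = decide (t ∈ pre s ∧ t ≠ s)
  laminar : ∀ s t, pre s ⊆ pre t ∨ pre t ⊆ pre s ∨ Disjoint (pre s) (pre t)
  recurrence : ∀ (x : S → ℝ) u,
    ∑ v ∈ pre u, x v = x u + ∑ s with next s = some u, ∑ v ∈ pre s, x v

/-- Summation by parts: sums over arbitrary sets in terms of a solution of the recurrence for
prefix sums. -/
lemma sum_eq_of_recurrence {R : Type*} [Ring R] {next : S → Option S} {x z : S → R}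
    (hz : ∀ u, z u = x u + ∑ s with next s = some u, z s) (Z : Finset S) :
    ∑ u ∈ Z, x u = ∑ s, ((if s ∈ Z then 1 else 0) -
      (if (next s).any (· ∈ Z) then 1 else 0)) * z s := by
  have h1 : ∀ u, x u = z u - ∑ s, if next s = some u then z s else 0 := by
    intro u
    rw [← Finset.sum_filter]
    exact eq_sub_of_add_eq (hz u).symm
  simp only [sub_mul, ite_mul, one_mul, zero_mul, Finset.sum_sub_distrib]
  rw [Finset.sum_congr rfl fun u _ => h1 u, Finset.sum_sub_distrib, Finset.sum_comm]
  congr 1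
  · simp
  · refine Finset.sum_congr rfl fun s _ => ?_
    cases next s with
    | none => simp
    | some v => simp

namespace IsPrefixSystem

variable {pre : S → Finset S} {next : S → Option S}

lemma injective (h : IsPrefixSystem pre next) : Function.Injective pre := by
  intro s t hst
  by_contra hne
  have h1 := h.next_mem s t
  have h2 := h.next_mem t t
  rw [hst] at h1
  rw [h1] at h2
  have := h.self_mem t
  simp [this, Ne.symm hne] at h2

lemma eq_sum_of_recurrence (h : IsPrefixSystem pre next) {R : Type*} [Ring R] {x z : S → R}
    (hz : ∀ u, z u = x u + ∑ s with next s = some u, z s) (s : S) :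
    z s = ∑ u ∈ pre s, x u := by
  rw [sum_eq_of_recurrence hz, Finset.sum_eq_single s]
  · rw [h.next_mem]; simp [h.self_mem]
  · intro t _ hts
    rw [h.next_mem]
    simp [hts]
  · simp

lemma sum_ends_eq {R : Type*} [Ring R] {next : S → Option S} {x z : S → R}
    (hz : ∀ u, z u = x u + ∑ s with next s = some u, z s) :
    ∑ s with next s = none, z s = ∑ u, x u := by
  rw [sum_eq_of_recurrence hz, Finset.sum_filter]
  refine Finset.sum_congr rfl fun s _ => ?_
  cases next s <;> simp

end IsPrefixSystem

section Network

variable {pre₁ pre₂ : S → Finset S} {next₁ next₂ : S → Option S}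

/-- The arcs of the network of two prefix systems: two copies of the ground set for the prefixes,
one for the elements, and an arc for the total sum. -/
abbrev Arc (S : Type*) := (S ⊕ S) ⊕ Option S

/-- The tails of the arcs. -/
def arcTail (next₂ : S → Option S) : Arc S → Option S ⊕ Option S
  | .inl (.inl s) => .inl (some s)
  | .inl (.inr s) => .inr (next₂ s)
  | .inr (some s) => .inr (some s)
  | .inr none => .inl none

/-- The heads of the arcs. -/
def arcHead (next₁ : S → Option S) : Arc S → Option S ⊕ Option S
  | .inl (.inl s) => .inl (next₁ s)
  | .inl (.inr s) => .inr (some s)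
  | .inr (some s) => .inl (some s)
  | .inr none => .inr none

/-- Circulations in the network of two prefix systems satisfy both recurrences. -/
lemma isCirculation_iff {R : Type*} [AddCommMonoid R] (x : Arc S → R) :
    IsCirculation (arcTail next₂) (arcHead next₁) x ↔
      (∀ u, x (.inl (.inl u)) =
        (∑ s with next₁ s = some u, x (.inl (.inl s))) + x (.inr (some u))) ∧
      x (.inr none) = (∑ s with next₁ s = none, x (.inl (.inl s))) ∧
      (∀ u, (∑ s with next₂ s = some u, x (.inl (.inr s))) + x (.inr (some u)) =
        x (.inl (.inr u))) ∧
      (∑ s with next₂ s = none, x (.inl (.inr s))) = x (.inr none) := by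
  simp only [IsCirculation, Sum.forall, Option.forall, Finset.sum_filter]
  simp only [Fintype.sum_sum_type, Fintype.sum_option]
  simp only [arcTail, arcHead, Sum.inl.injEq, Sum.inr.injEq, reduceCtorEq, if_false, Finset.sum_const_zero,
    add_zero, zero_add, Option.some.injEq, Finset.sum_ite_eq',
    Finset.mem_univ, if_true]
  tauto

/-- The integral roundings of `x` with respect to two prefix systems, the elements and the total
sum. -/
def roundings (pre₁ pre₂ : S → Finset S) (x : S → ℝ) : Set (S → ℤ) :=
  {z | (∀ s, ⌊∑ u ∈ pre₁ s, x u⌋ ≤ ∑ u ∈ pre₁ s, z u ∧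
      ∑ u ∈ pre₁ s, z u ≤ ⌈∑ u ∈ pre₁ s, x u⌉) ∧
    (∀ s, ⌊∑ u ∈ pre₂ s, x u⌋ ≤ ∑ u ∈ pre₂ s, z u ∧
      ∑ u ∈ pre₂ s, z u ≤ ⌈∑ u ∈ pre₂ s, x u⌉) ∧
    (∀ s, ⌊x s⌋ ≤ z s ∧ z s ≤ ⌈x s⌉) ∧
    ⌊∑ s, x s⌋ ≤ ∑ s, z s ∧ ∑ s, z s ≤ ⌈∑ s, x s⌉}

theorem mem_convexHull_roundings (h₁ : IsPrefixSystem pre₁ next₁)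
    (h₂ : IsPrefixSystem pre₂ next₂) (x : S → ℝ) :
    x ∈ convexHull ℝ (toReal '' roundings pre₁ pre₂ x) := by
  let X : Arc S → ℝ
    | .inl (.inl s) => ∑ u ∈ pre₁ s, x u
    | .inl (.inr s) => ∑ u ∈ pre₂ s, x u
    | .inr (some s) => x s
    | .inr none => ∑ s, x s
  have hX : IsCirculation (arcTail next₂) (arcHead next₁) X := by
    rw [isCirculation_iff]
    refine ⟨fun u => ?_, (IsPrefixSystem.sum_ends_eq (h₁.recurrence x)).symm, fun u => ?_,
      IsPrefixSystem.sum_ends_eq (h₂.recurrence x)⟩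
    · exact (h₁.recurrence x u).trans (add_comm _ _)
    · exact (add_comm _ _).trans (h₂.recurrence x u).symm
  have hmem := hX.mem_convexHull
  let π : (Arc S → ℝ) →ₗ[ℝ] (S → ℝ) := LinearMap.funLeft ℝ ℝ fun s => .inr (some s)
  have himg := Set.mem_image_of_mem π hmem
  rw [π.image_convexHull] at himg
  refine convexHull_mono ?_ himg
  rintro _ ⟨_, ⟨y, ⟨hy, hb⟩, rfl⟩, rfl⟩
  refine ⟨fun s => y (.inr (some s)), ?_, rfl⟩
  rw [isCirculation_iff] at hy
  obtain ⟨hy1, hy2, hy3, hy4⟩ := hy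
  have hr1 := fun u => (hy1 u).trans (add_comm _ _)
  have hr2 := fun u => (hy3 u).symm.trans (add_comm _ _)
  refine ⟨fun s => ?_, fun s => ?_, fun s => hb (.inr (some s)), ?_⟩
  · rw [← h₁.eq_sum_of_recurrence (z := fun s => y (.inl (.inl s))) hr1 s]
    exact hb (.inl (.inl s))
  · rw [← h₂.eq_sum_of_recurrence (z := fun s => y (.inl (.inr s))) hr2 s]
    exact hb (.inl (.inr s))
  · rw [← IsPrefixSystem.sum_ends_eq (z := fun s => y (.inl (.inl s))) hr1, ← hy2]
    exact hb (.inr none)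

end Network

end PrefixSystem

section Bounds

lemma lo_le_int {a : WithBot ℤ} {z : ℤ} : lo a ≤ ((z : ℝ) : EReal) ↔ a ≤ (z : WithBot ℤ) := by
  cases a with
  | bot => simp [lo]
  | coe a => simp [lo]

lemma int_le_up {a : WithTop ℤ} {z : ℤ} : ((z : ℝ) : EReal) ≤ up a ↔ (z : WithTop ℤ) ≤ a := by
  cases a with
  | top => simp [up]
  | coe a => simp [up]

lemma lo_le_floor {a : WithBot ℤ} {r : ℝ} (h : lo a ≤ (r : EReal)) {z : ℤ} (hz : ⌊r⌋ ≤ z) :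
    a ≤ (z : WithBot ℤ) := by
  cases a with
  | bot => simp
  | coe a =>
    have h' : (a : ℝ) ≤ r := EReal.coe_le_coe_iff.1 h
    exact WithBot.coe_le_coe.2 ((Int.le_floor.2 h').trans hz)

lemma ceil_le_up {a : WithTop ℤ} {r : ℝ} (h : (r : EReal) ≤ up a) {z : ℤ} (hz : z ≤ ⌈r⌉) :
    (z : WithTop ℤ) ≤ a := by
  cases a with
  | top => simp
  | coe a =>
    have h' : r ≤ (a : ℝ) := EReal.coe_le_coe_iff.1 h
    exact WithTop.coe_le_coe.2 (hz.trans (Int.ceil_le.2 h'))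

/-- Reals between a lower and an upper bound form an interval. -/
lemma convex_between (a : WithBot ℤ) (b : WithTop ℤ) :
    Convex ℝ {r : ℝ | lo a ≤ (r : EReal) ∧ (r : EReal) ≤ up b} := by
  refine Set.OrdConnected.convex ⟨fun x hx y hy z hz => ?_⟩
  exact ⟨hx.1.trans (EReal.coe_le_coe_iff.2 hz.1), (EReal.coe_le_coe_iff.2 hz.2).trans hy.2⟩

lemma convex_sum_between {S : Type*} (Z : Finset S) (a : WithBot ℤ) (b : WithTop ℤ) :
    Convex ℝ {x : S → ℝ | lo a ≤ ((∑ u ∈ Z, x u : ℝ) : EReal) ∧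
      ((∑ u ∈ Z, x u : ℝ) : EReal) ≤ up b} := by
  have := (convex_between a b).linear_preimage (∑ u ∈ Z, LinearMap.proj u : (S → ℝ) →ₗ[ℝ] ℝ)
  have heq : {x : S → ℝ | lo a ≤ ((∑ u ∈ Z, x u : ℝ) : EReal) ∧
      ((∑ u ∈ Z, x u : ℝ) : EReal) ≤ up b} =
      (∑ u ∈ Z, LinearMap.proj u : (S → ℝ) →ₗ[ℝ] ℝ) ⁻¹'
        {r : ℝ | lo a ≤ (r : EReal) ∧ (r : EReal) ≤ up b} := by
    ext x
    simp only [Set.mem_preimage, Set.mem_ofPred_eq, LinearMap.coe_sum, Finset.sum_apply,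
      LinearMap.proj_apply]
  rwa [heq]

lemma convex_prefixPoly {S : Type*} (pre : S → Finset S)
    (Φ : S → WithBot ℤ) (Γ : S → WithTop ℤ) : Convex ℝ (prefixPoly pre Φ Γ) := by
  rw [prefixPoly, Set.ofPred_forall]
  exact convex_iInter fun s => convex_sum_between _ _ _

lemma convex_box {S : Type*} (f : S → WithBot ℤ) (g : S → WithTop ℤ) :
    Convex ℝ (box f g) := by
  rw [box, Set.ofPred_forall]
  refine convex_iInter fun s => ?_
  simpa using convex_sum_between {s} (f s) (g s)

lemma convex_plank {S : Type*} [Fintype S] (α : WithBot ℤ) (β : WithTop ℤ) :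
    Convex ℝ (plank (S := S) α β) := convex_sum_between _ _ _

lemma toReal_mem_prefixPoly {S : Type*} {pre : S → Finset S} {Φ : S → WithBot ℤ} {Γ : S → WithTop ℤ}
    {z : S → ℤ} : toReal z ∈ prefixPoly pre Φ Γ ↔
      ∀ s, Φ s ≤ ((∑ u ∈ pre s, z u : ℤ) : WithBot ℤ) ∧
        ((∑ u ∈ pre s, z u : ℤ) : WithTop ℤ) ≤ Γ s := by
  simp only [prefixPoly, toReal, Set.mem_ofPred_eq, ← Int.cast_sum, lo_le_int, int_le_up]

lemma toReal_mem_box {S : Type*} {f : S → WithBot ℤ} {g : S → WithTop ℤ} {z : S → ℤ} :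
    toReal z ∈ box f g ↔ ∀ s, f s ≤ (z s : WithBot ℤ) ∧ (z s : WithTop ℤ) ≤ g s := by
  simp only [box, toReal, Set.mem_ofPred_eq, lo_le_int, int_le_up]

lemma toReal_mem_plank {S : Type*} [Fintype S] {α : WithBot ℤ} {β : WithTop ℤ} {z : S → ℤ} :
    toReal z ∈ plank α β ↔
      α ≤ ((∑ s, z s : ℤ) : WithBot ℤ) ∧ ((∑ s, z s : ℤ) : WithTop ℤ) ≤ β := by
  simp only [plank, toReal, Set.mem_ofPred_eq, ← Int.cast_sum, lo_le_int, int_le_up]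

lemma prefixPoly_bot_top {S : Type*} (pre : S → Finset S) :
    prefixPoly pre (fun _ => ⊥) (fun _ => ⊤) = Set.univ := by
  ext; simp [prefixPoly, lo, up]

lemma box_bot_top {S : Type*} : box (fun _ : S => ⊥) (fun _ => ⊤) = Set.univ := by
  ext; simp [box, lo, up]

lemma plank_bot_top {S : Type*} [Fintype S] : plank (S := S) ⊥ ⊤ = Set.univ := by
  ext; simp [plank, lo, up]

end Bounds

section Hull

variable {S : Type*} [Fintype S] [DecidableEq S]
  {pre₁ pre₂ : S → Finset S} {next₁ next₂ : S → Option S}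

/-- The polyhedron cut out by integral bounds on the prefixes of two prefix systems, on the
elements and on the total sum is integral. -/
theorem isIntegral_inter (h₁ : IsPrefixSystem pre₁ next₁) (h₂ : IsPrefixSystem pre₂ next₂)
    (Φ₁ Φ₂ f : S → WithBot ℤ) (Γ₁ Γ₂ g : S → WithTop ℤ) (α : WithBot ℤ) (β : WithTop ℤ) :
    IsIntegral ((prefixPoly pre₁ Φ₁ Γ₁ ∩ prefixPoly pre₂ Φ₂ Γ₂) ∩ (box f g ∩ plank α β)) := by
  refine subset_antisymm (convexHull_min ?_ (((convex_prefixPoly _ _ _).inter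
    (convex_prefixPoly _ _ _)).inter ((convex_box _ _).inter (convex_plank _ _)))) ?_
  · rintro _ ⟨z, hz, rfl⟩
    exact hz
  · rintro x ⟨⟨hx1, hx2⟩, hx3, hx4⟩
    refine convexHull_mono (Set.image_mono ?_) (mem_convexHull_roundings h₁ h₂ x)
    rintro z ⟨hz1, hz2, hz3, hz4⟩
    refine ⟨⟨toReal_mem_prefixPoly.2 fun s => ?_, toReal_mem_prefixPoly.2 fun s => ?_⟩,
      toReal_mem_box.2 fun s => ?_, toReal_mem_plank.2 ?_⟩
    · exact ⟨lo_le_floor (hx1 s).1 (hz1 s).1, ceil_le_up (hx1 s).2 (hz1 s).2⟩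
    · exact ⟨lo_le_floor (hx2 s).1 (hz2 s).1, ceil_le_up (hx2 s).2 (hz2 s).2⟩
    · exact ⟨lo_le_floor (hx3 s).1 (hz3 s).1, ceil_le_up (hx3 s).2 (hz3 s).2⟩
    · exact ⟨lo_le_floor hx4.1 hz4.1, ceil_le_up hx4.2 hz4.2⟩

end Hull
section Duality

/-- The order-reversing negation from upper to lower bounds. -/
def negUp : WithTop ℤ → WithBot ℤ
  | ⊤ => ⊥
  | (a : ℤ) => ((-a : ℤ) : WithBot ℤ)

/-- The order-reversing negation from lower to upper bounds. -/
def negLo : WithBot ℤ → WithTop ℤ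
  | ⊥ => ⊤
  | (a : ℤ) => ((-a : ℤ) : WithTop ℤ)

lemma negUp_add (a b : WithTop ℤ) : negUp (a + b) = negUp a + negUp b := by
  cases a <;> cases b <;> try rfl
  rename_i a b
  change (((-(a + b) : ℤ)) : WithBot ℤ) = ((-a + -b : ℤ) : WithBot ℤ)
  rw [neg_add]

lemma negUp_le_negUp {a b : WithTop ℤ} (h : a ≤ b) : negUp b ≤ negUp a := by
  cases b with
  | top => exact bot_le
  | coe b =>
    cases a with
    | top => exact absurd h (by simp)
    | coe a => exact WithBot.coe_le_coe.2 (neg_le_neg (WithTop.coe_le_coe.1 h))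

lemma negUp_negLo (a : WithBot ℤ) : negUp (negLo a) = a := by
  cases a with
  | bot => rfl
  | coe a => exact congrArg _ (neg_neg a)

lemma up_add (a b : WithTop ℤ) : up (a + b) = up a + up b := by
  cases a with
  | top => cases b <;> simp [up]
  | coe a =>
    cases b with
    | top => simp [up]
    | coe b =>
      rw [← WithTop.coe_add]
      simp [up]

lemma up_zero : up 0 = 0 := by
  change ((((0 : ℤ) : ℝ)) : EReal) = 0
  simp

lemma up_mono : Monotone up := by
  intro a b h
  cases b with
  | top => exact le_top
  | coe b =>
    cases a with
    | top => exact absurd h (by simp)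
    | coe a => exact EReal.coe_le_coe_iff.2 (Int.cast_le.2 (WithTop.coe_le_coe.1 h))

lemma lo_negUp (a : WithTop ℤ) : lo (negUp a) = - up a := by
  cases a with
  | top => simp [negUp, lo, up]
  | coe a => simp [negUp, lo, up]

lemma up_negLo (a : WithBot ℤ) : up (negLo a) = - lo a := by
  cases a with
  | bot => simp [negLo, lo, up]
  | coe a =>
    change (((-a : ℤ) : ℝ) : EReal) = -((a : ℝ) : EReal)
    rw [Int.cast_neg, EReal.coe_neg]

lemma add_negLo_nonneg {φ : WithBot ℤ} {γ : WithTop ℤ} (h : lo φ ≤ up γ) :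
    0 ≤ γ + negLo φ := by
  cases φ with
  | bot => simp [negLo]
  | coe a =>
    cases γ with
    | top => simp
    | coe b =>
      have : a ≤ b := by simpa [lo, up] using h
      change ((0 : ℤ) : WithTop ℤ) ≤ ((b + -a : ℤ) : WithTop ℤ)
      exact WithTop.coe_le_coe.2 (by omega)

end Duality

section CutFunction

/-- The weight of a pair of an element and its successor: `a` if only the element is chosen, `c`
if only the successor is. -/
def cutWeight (a c : WithTop ℤ) : Bool → Bool → WithTop ℤ
  | true, false => a
  | false, true => c
  | _, _ => 0

lemma cutWeight_submodular {a c : WithTop ℤ} (h : 0 ≤ a + c) (p q p' q' : Bool) :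
    cutWeight a c (p && p') (q && q') + cutWeight a c (p || p') (q || q') ≤
      cutWeight a c p q + cutWeight a c p' q' := by
  cases p <;> cases q <;> cases p' <;> cases q' <;> simp [cutWeight, h, add_comm]

lemma cutWeight_cross {a c : WithTop ℤ} (h : 0 ≤ a + c) (p q p' q' : Bool) :
    cutWeight a c (p && !p') (q && !q') + cutWeight c a (p' && !p) (q' && !q) ≤
      cutWeight a c p q + cutWeight c a p' q' := by
  cases p <;> cases q <;> cases p' <;> cases q' <;> simp [cutWeight, h, add_comm]

lemma cutWeight_upper {φ : WithBot ℤ} {γ : WithTop ℤ} {y : ℝ} (h₁ : lo φ ≤ (y : EReal))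
    (h₂ : (y : EReal) ≤ up γ) (p q : Bool) :
    (((((if p then 1 else 0) - (if q then 1 else 0)) * y : ℝ)) : EReal) ≤
      up (cutWeight γ (negLo φ) p q) := by
  cases p <;> cases q <;> simp [cutWeight, up_zero, h₂, up_negLo, EReal.neg_le_neg_iff, h₁]

variable {S : Type*} [Fintype S] [DecidableEq S]

/-- The cut function on sets, with weight `w s` if `s` but not its successor is in the set, and
`w' s` if the successor but not `s` is. -/
def cutFun (next : S → Option S) (w w' : S → WithTop ℤ) (Z : Finset S) : WithTop ℤ :=
  ∑ s, cutWeight (w s) (w' s) (decide (s ∈ Z)) ((next s).any (· ∈ Z))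

variable {next : S → Option S} {w w' : S → WithTop ℤ}

lemma cutFun_empty : cutFun next w w' ∅ = 0 := by
  refine Finset.sum_eq_zero fun s _ => ?_
  cases next s <;> simp [cutWeight]

lemma cutFun_submodular (h : ∀ s, 0 ≤ w s + w' s) (X Y : Finset S) :
    cutFun next w w' (X ∩ Y) + cutFun next w w' (X ∪ Y) ≤
      cutFun next w w' X + cutFun next w w' Y := by
  simp only [cutFun, ← Finset.sum_add_distrib]
  refine Finset.sum_le_sum fun s _ => ?_
  convert cutWeight_submodular (h s) (decide (s ∈ X)) ((next s).any (· ∈ X)) (decide (s ∈ Y))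
    ((next s).any (· ∈ Y)) using 3
  · simp
  · cases next s <;> simp
  · simp
  · cases next s <;> simp

lemma cutFun_cross (h : ∀ s, 0 ≤ w s + w' s) (X Y : Finset S) :
    cutFun next w w' (X \ Y) + cutFun next w' w (Y \ X) ≤
      cutFun next w w' X + cutFun next w' w Y := by
  simp only [cutFun, ← Finset.sum_add_distrib]
  refine Finset.sum_le_sum fun s _ => ?_
  convert cutWeight_cross (h s) (decide (s ∈ X)) ((next s).any (· ∈ X)) (decide (s ∈ Y))
    ((next s).any (· ∈ Y)) using 3
  · simp
  · cases next s <;> simp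
  · simp
  · cases next s <;> simp

lemma isStrongPair_cutFun (h : ∀ s, 0 ≤ w s + w' s) :
    IsStrongPair (fun Z => negUp (cutFun next w' w Z)) (cutFun next w w') where
  p_empty := by rw [cutFun_empty]; rfl
  b_empty := cutFun_empty
  supermodular X Y := by
    rw [← negUp_add, ← negUp_add]
    exact negUp_le_negUp (cutFun_submodular (fun s => add_comm (w s) (w' s) ▸ h s) X Y)
  submodular := cutFun_submodular h
  cross X Y := by
    simp only [lo_negUp, sub_eq_add_neg, neg_neg, ← up_add]
    exact up_mono (cutFun_cross h X Y)

lemma up_sum {ι : Type*} (s : Finset ι) (a : ι → WithTop ℤ) :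
    up (∑ i ∈ s, a i) = ∑ i ∈ s, up (a i) :=
  map_sum (⟨⟨up, up_zero⟩, up_add⟩ : WithTop ℤ →+ EReal) a s

lemma coe_sum_ereal {ι : Type*} (s : Finset ι) (a : ι → ℝ) :
    ((∑ i ∈ s, a i : ℝ) : EReal) = ∑ i ∈ s, (a i : EReal) :=
  map_sum (⟨⟨Real.toEReal, EReal.coe_zero⟩, EReal.coe_add⟩ : ℝ →+ EReal) a s

variable {pre : S → Finset S} {Φ : S → WithBot ℤ} {Γ : S → WithTop ℤ}

lemma cutFun_pre (h : IsPrefixSystem pre next) (s : S) : cutFun next w w' (pre s) = w s := by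
  rw [cutFun, Finset.sum_eq_single s]
  · rw [h.next_mem]
    simp [h.self_mem, cutWeight]
  · intro t _ hts
    rw [h.next_mem]
    by_cases ht : t ∈ pre s <;> simp [ht, hts, cutWeight]
  · simp

lemma prefixPoly_eq_gPoly_cutFun (h : IsPrefixSystem pre next) :
    prefixPoly pre Φ Γ = gPoly (fun Z => negUp (cutFun next (fun s => negLo (Φ s)) Γ Z))
      (cutFun next Γ fun s => negLo (Φ s)) := by
  ext x
  constructor
  · intro hx Z
    have hsum := sum_eq_of_recurrence (z := fun s => ∑ u ∈ pre s, x u)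
      (fun u => h.recurrence x u) Z
    rw [hsum, lo_negUp, EReal.neg_le, ← EReal.coe_neg, ← Finset.sum_neg_distrib, coe_sum_ereal,
      coe_sum_ereal, cutFun, cutFun, up_sum, up_sum]
    refine ⟨Finset.sum_le_sum fun s _ => ?_, Finset.sum_le_sum fun s _ => ?_⟩
    swap
    · simpa only [decide_eq_true_eq] using cutWeight_upper (hx s).1 (hx s).2
        (decide (s ∈ Z)) ((next s).any (· ∈ Z))
    have := cutWeight_upper (hx s).1 (hx s).2 ((next s).any (· ∈ Z)) (decide (s ∈ Z))
    convert this using 2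
    · simp only [decide_eq_true_eq]
      ring
    · cases decide (s ∈ Z) <;> cases (next s).any (· ∈ Z) <;> rfl
  · intro hx s
    have := hx (pre s)
    simpa only [cutFun_pre h, negUp_negLo] using this

theorem isGPolymatroid_prefixPoly (h : IsPrefixSystem pre next)
    (hΦΓ : ∀ s, lo (Φ s) ≤ up (Γ s)) : IsGPolymatroid (prefixPoly pre Φ Γ) :=
  Or.inr ⟨_, _, isStrongPair_cutFun fun s => add_negLo_nonneg (hΦΓ s),
    prefixPoly_eq_gPoly_cutFun h⟩

open Classical in
/-- Prefix-bounded g-polymatroids are laminar. -/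
theorem isLaminarGPolymatroid_prefixPoly (h : IsPrefixSystem pre next)
    (hΦΓ : ∀ s, lo (Φ s) ≤ up (Γ s)) : IsLaminarGPolymatroid (prefixPoly pre Φ Γ) := by
  have hne : ∀ s, (pre s).Nonempty := fun s => ⟨s, h.self_mem s⟩
  refine ⟨isGPolymatroid_prefixPoly h hΦΓ, Set.range pre,
    fun Z => if hZ : ∃ s, pre s = Z then Φ hZ.choose else if Z = ∅ then 0 else ⊥,
    fun Z => if hZ : ∃ s, pre s = Z then Γ hZ.choose else if Z = ∅ then 0 else ⊤,
    ?_, ?_, ?_, ?_, ?_, ?_⟩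
  · rintro _ ⟨s, rfl⟩ _ ⟨t, rfl⟩ ⟨h1, h2, h3⟩
    rcases h.laminar s t with hl | hl | hl
    · exact h1.ne_empty (Finset.sdiff_eq_empty_iff_subset.2 hl)
    · exact h2.ne_empty (Finset.sdiff_eq_empty_iff_subset.2 hl)
    · exact h3.ne_empty (Finset.disjoint_iff_inter_eq_empty.1 hl)
  · rintro _ ⟨s, rfl⟩
    exact hne s
  · refine (dif_neg ?_).trans (if_pos rfl)
    rintro ⟨s, hs⟩
    exact (hne s).ne_empty hs
  · refine (dif_neg ?_).trans (if_pos rfl)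
    rintro ⟨s, hs⟩
    exact (hne s).ne_empty hs
  · intro Z hZ hZL
    have hZL' : ¬ ∃ s, pre s = Z := hZL
    simp [hZL', hZ.ne_empty]
  · ext x
    constructor
    · intro hx Z
      by_cases hZ : ∃ s, pre s = Z
      · have := hx hZ.choose
        rw [hZ.choose_spec] at this
        simpa only [dif_pos hZ] using this
      · simp only [dif_neg hZ]
        by_cases h0 : Z = ∅
        · subst h0
          simp [up_zero, show lo 0 = 0 by rw [← neg_neg (lo 0), ← up_negLo]; simp [negLo, up]]
        · simp [h0, lo, up]
    · intro hx s
      have hs : ∃ t, pre t = pre s := ⟨s, rfl⟩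
      have := hx (pre s)
      simp only [dif_pos hs] at this
      rwa [h.injective hs.choose_spec] at this

end CutFunction
section Chains

variable {n : ℕ}

/-- The successor in the chain `Fin n`, if there is one. -/
def finNext (j : Fin n) : Option (Fin n) :=
  if h : (j : ℕ) + 1 < n then some ⟨j + 1, h⟩ else none

lemma finNext_eq_some {j k : Fin n} : finNext j = some k ↔ (k : ℕ) = j + 1 := by
  unfold finNext
  split_ifs with h
  · simp only [Option.some.injEq, Fin.ext_iff]
    exact eq_comm
  · simp only [false_iff]
    have := k.2
    omega

lemma any_finNext (j k : Fin n) :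
    (finNext j).any (· ≤ k) = decide (j ≤ k ∧ j ≠ k) := by
  rw [Bool.eq_iff_iff]
  simp only [Option.any_eq_true, finNext_eq_some, decide_eq_true_eq, Fin.le_def, ne_eq,
    Fin.ext_iff]
  constructor
  · rintro ⟨l, h1, h2⟩
    omega
  · rintro ⟨h1, h2⟩
    exact ⟨⟨j + 1, by have := k.2; omega⟩, rfl, by simp only; omega⟩

lemma sum_Iic_recurrence (x : Fin n → ℝ) (k : Fin n) :
    ∑ v ∈ Finset.Iic k, x v = x k + ∑ j with finNext j = some k, ∑ v ∈ Finset.Iic j, x v := by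
  obtain ⟨k, hk⟩ := k
  cases k with
  | zero =>
    have h1 : (Finset.univ.filter fun j : Fin n => finNext j = some ⟨0, hk⟩) = ∅ := by
      ext j; simp [finNext_eq_some]
    have h2 : Finset.Iic (⟨0, hk⟩ : Fin n) = {⟨0, hk⟩} := by
      ext j; simp [Fin.le_def, Fin.ext_iff]
    simp [h1, h2]
  | succ k =>
    have h1 : (Finset.univ.filter fun j : Fin n => finNext j = some ⟨k + 1, hk⟩) =
        {⟨k, by omega⟩} := by
      ext j
      simp only [finNext_eq_some, Finset.mem_filter, Finset.mem_univ, true_and,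
        Finset.mem_singleton, Fin.ext_iff]
      omega
    have h2 : Finset.Iic (⟨k + 1, hk⟩ : Fin n) =
        insert ⟨k + 1, hk⟩ (Finset.Iic ⟨k, by omega⟩) := by
      ext j
      simp only [Finset.mem_Iic, Finset.mem_insert, Fin.le_def, Fin.ext_iff]
      omega
    rw [h1, Finset.sum_singleton, h2, Finset.sum_insert]
    simp [Fin.le_def]

/-- Membership in an elementary prefix-bounded g-polymatroid. -/
lemma mem_elementary {φ : Fin n → WithBot ℤ} {γ : Fin n → WithTop ℤ} {x : Fin n → ℝ} :
    x ∈ elementary φ γ ↔ ∀ k, lo (φ k) ≤ ((∑ v ∈ Finset.Iic k, x v : ℝ) : EReal) ∧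
      ((∑ v ∈ Finset.Iic k, x v : ℝ) : EReal) ≤ up (γ k) := by
  have hmax : ∀ k : Fin n, (Finset.Iic k).max' ⟨k, by simp⟩ = k := fun k =>
    le_antisymm (Finset.max'_le _ _ _ fun y hy => Finset.mem_Iic.1 hy)
      (Finset.le_max' _ _ (by simp))
  constructor
  · intro hx k
    have hk : (Finset.Iic k).Nonempty := ⟨k, by simp⟩
    have := hx (Finset.Iic k)
    simpa only [lowerSetFun, upperSetFun, dif_pos hk, hmax, if_true] using this
  · intro hx Z
    by_cases hZ : Z.Nonempty
    · simp only [lowerSetFun, upperSetFun, dif_pos hZ]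
      by_cases hI : Z = Finset.Iic (Z.max' hZ)
      · rw [if_pos hI, if_pos hI]
        have := hx (Z.max' hZ)
        rwa [← hI] at this
      · rw [if_neg hI, if_neg hI]
        exact ⟨bot_le, le_top⟩
    · rw [Finset.not_nonempty_iff_eq_empty] at hZ
      subst hZ
      have h0 : lo 0 = 0 := by
        change (((0 : ℤ) : ℝ) : EReal) = 0
        simp
      simp [lowerSetFun, upperSetFun, up_zero, h0]

end Chains

section Matrices

variable {m n : ℕ}

/-- The right neighbour of a position. -/
def hNext (s : Fin m × Fin n) : Option (Fin m × Fin n) := (finNext s.2).map fun j => (s.1, j)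

/-- The lower neighbour of a position. -/
def vNext (s : Fin m × Fin n) : Option (Fin m × Fin n) := (finNext s.1).map fun i => (i, s.2)

lemma mem_hPre {s t : Fin m × Fin n} : t ∈ hPre s ↔ t.1 = s.1 ∧ t.2 ≤ s.2 := by
  simp only [hPre, Finset.mem_product, Finset.mem_singleton, Finset.mem_Iic]

lemma mem_vPre {s t : Fin m × Fin n} : t ∈ vPre s ↔ t.1 ≤ s.1 ∧ t.2 = s.2 := by
  simp only [vPre, Finset.mem_product, Finset.mem_singleton, Finset.mem_Iic]

lemma sum_hPre {R : Type*} [AddCommMonoid R] (x : Fin m × Fin n → R) (s : Fin m × Fin n) :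
    ∑ u ∈ hPre s, x u = ∑ j ∈ Finset.Iic s.2, x (s.1, j) := by
  rw [hPre, Finset.sum_product, Finset.sum_singleton]

lemma sum_vPre {R : Type*} [AddCommMonoid R] (x : Fin m × Fin n → R) (s : Fin m × Fin n) :
    ∑ u ∈ vPre s, x u = ∑ i ∈ Finset.Iic s.1, x (i, s.2) := by
  rw [vPre, Finset.sum_product]
  simp only [Finset.sum_singleton]

lemma hNext_eq_some {s u : Fin m × Fin n} :
    hNext s = some u ↔ s.1 = u.1 ∧ finNext s.2 = some u.2 := by
  simp only [hNext, Option.map_eq_some_iff, Prod.ext_iff]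
  constructor
  · rintro ⟨a, h1, h2, rfl⟩
    exact ⟨h2, h1⟩
  · rintro ⟨h1, h2⟩
    exact ⟨_, h2, h1, rfl⟩

lemma vNext_eq_some {s u : Fin m × Fin n} :
    vNext s = some u ↔ finNext s.1 = some u.1 ∧ s.2 = u.2 := by
  simp only [vNext, Option.map_eq_some_iff, Prod.ext_iff]
  constructor
  · rintro ⟨a, h1, rfl, h2⟩
    exact ⟨h1, h2⟩
  · rintro ⟨h1, h2⟩
    exact ⟨_, h1, rfl, h2⟩

lemma sum_hNext (f : Fin m × Fin n → ℝ) (u : Fin m × Fin n) :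
    ∑ s with hNext s = some u, f s = ∑ j with finNext j = some u.2, f (u.1, j) := by
  have : (Finset.univ.filter fun s : Fin m × Fin n => hNext s = some u) =
      {u.1} ×ˢ Finset.univ.filter fun j => finNext j = some u.2 := by
    ext s
    simp only [hNext_eq_some, Finset.mem_product, Finset.mem_filter, Finset.mem_univ, true_and,
      Finset.mem_singleton]
  rw [this, Finset.sum_product, Finset.sum_singleton]

lemma sum_vNext (f : Fin m × Fin n → ℝ) (u : Fin m × Fin n) :
    ∑ s with vNext s = some u, f s = ∑ i with finNext i = some u.1, f (i, u.2) := by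
  have : (Finset.univ.filter fun s : Fin m × Fin n => vNext s = some u) =
      (Finset.univ.filter fun i => finNext i = some u.1) ×ˢ {u.2} := by
    ext s
    simp only [vNext_eq_some, Finset.mem_product, Finset.mem_filter, Finset.mem_univ, true_and,
      Finset.mem_singleton]
  rw [this, Finset.sum_product]
  simp only [Finset.sum_singleton]

/-- The horizontal prefixes form a prefix system. -/
theorem isPrefixSystem_hPre : IsPrefixSystem (hPre (m := m) (n := n)) hNext where
  self_mem s := by simp [mem_hPre]
  next_mem s t := by
    have := any_finNext t.2 s.2
    by_cases h : t.1 = s.1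
    · simp only [hNext, Option.any_map, mem_hPre, h, true_and, this, ne_eq,
        Prod.ext_iff]
    · simp only [hNext, Option.any_map, mem_hPre, h, false_and, decide_false]
      cases finNext t.2 <;> rfl
  laminar s t := by
    by_cases h : s.1 = t.1
    · rcases le_total s.2 t.2 with h2 | h2
      · refine Or.inl fun u hu => ?_
        rw [mem_hPre] at hu ⊢
        exact ⟨hu.1.trans h, hu.2.trans h2⟩
      · refine Or.inr (Or.inl fun u hu => ?_)
        rw [mem_hPre] at hu ⊢
        exact ⟨hu.1.trans h.symm, hu.2.trans h2⟩
    · refine Or.inr (Or.inr (Finset.disjoint_left.2 fun u hs ht => h ?_))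
      exact (mem_hPre.1 hs).1.symm.trans (mem_hPre.1 ht).1
  recurrence x u := by
    rw [sum_hNext, sum_hPre, sum_Iic_recurrence fun j => x (u.1, j)]
    simp only [sum_hPre]

/-- The vertical prefixes form a prefix system. -/
theorem isPrefixSystem_vPre : IsPrefixSystem (vPre (m := m) (n := n)) vNext where
  self_mem s := by simp [mem_vPre]
  next_mem s t := by
    have := any_finNext t.1 s.1
    by_cases h : t.2 = s.2
    · simp only [vNext, Option.any_map, mem_vPre, h, and_true, this, ne_eq,
        Prod.ext_iff]
    · simp only [vNext, Option.any_map, mem_vPre, h, and_false, false_and,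
        decide_false]
      cases finNext t.1 <;> rfl
  laminar s t := by
    by_cases h : s.2 = t.2
    · rcases le_total s.1 t.1 with h2 | h2
      · refine Or.inl fun u hu => ?_
        rw [mem_vPre] at hu ⊢
        exact ⟨hu.1.trans h2, hu.2.trans h⟩
      · refine Or.inr (Or.inl fun u hu => ?_)
        rw [mem_vPre] at hu ⊢
        exact ⟨hu.1.trans h2, hu.2.trans h.symm⟩
    · refine Or.inr (Or.inr (Finset.disjoint_left.2 fun u hs ht => h ?_))
      exact (mem_vPre.1 hs).2.symm.trans (mem_vPre.1 ht).2
  recurrence x u := by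
    rw [sum_vNext, sum_vPre, sum_Iic_recurrence fun i => x (i, u.2)]
    simp only [sum_vPre]

lemma hPoly_eq_rowDirectSum (Φ : Fin m × Fin n → WithBot ℤ) (Γ : Fin m × Fin n → WithTop ℤ) :
    hPoly Φ Γ = rowDirectSum fun i => elementary (fun j => Φ (i, j)) (fun j => Γ (i, j)) := by
  ext x
  simp only [hPoly, rowDirectSum, Set.mem_ofPred_eq, mem_elementary, sum_hPre, Prod.forall]

lemma vPoly_eq_colDirectSum (Φ : Fin m × Fin n → WithBot ℤ) (Γ : Fin m × Fin n → WithTop ℤ) :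
    vPoly Φ Γ = colDirectSum fun j => elementary (fun i => Φ (i, j)) (fun i => Γ (i, j)) := by
  ext x
  simp only [vPoly, colDirectSum, Set.mem_ofPred_eq, mem_elementary, sum_vPre, Prod.forall]
  exact forall_comm

variable {Φ₁ Φ₂ f : Fin m × Fin n → WithBot ℤ} {Γ₁ Γ₂ g : Fin m × Fin n → WithTop ℤ}
  {α : WithBot ℤ} {β : WithTop ℤ}

lemma hPoly_eq_prefixPoly : hPoly Φ₁ Γ₁ = prefixPoly hPre Φ₁ Γ₁ := rfl

lemma vPoly_eq_prefixPoly : vPoly Φ₁ Γ₁ = prefixPoly vPre Φ₁ Γ₁ := rfl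

lemma pbm_eq : pbm Φ₁ Γ₁ Φ₂ Γ₂ = {z | toReal z ∈ hPoly Φ₁ Γ₁ ∩ vPoly Φ₂ Γ₂} := by
  ext z
  rw [hPoly_eq_prefixPoly, vPoly_eq_prefixPoly]
  simp only [pbm, Set.mem_ofPred_eq, Set.mem_inter_iff, toReal_mem_prefixPoly, forall_and]

lemma bounded_eq : bounded f g α β = {z | toReal z ∈ box f g ∩ plank α β} := by
  ext z
  simp only [bounded, Set.mem_ofPred_eq, Set.mem_inter_iff, toReal_mem_box, toReal_mem_plank]

theorem convexHull_pbm_inter_bounded :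
    convexHull ℝ (toReal '' (pbm Φ₁ Γ₁ Φ₂ Γ₂ ∩ bounded f g α β)) =
      (hPoly Φ₁ Γ₁ ∩ vPoly Φ₂ Γ₂) ∩ (box f g ∩ plank α β) := by
  rw [pbm_eq, bounded_eq]
  exact isIntegral_inter isPrefixSystem_hPre isPrefixSystem_vPre Φ₁ Φ₂ f Γ₁ Γ₂ g α β

lemma isIntegral_hPoly_inter_vPoly : IsIntegral (hPoly Φ₁ Γ₁ ∩ vPoly Φ₂ Γ₂) := by
  have := isIntegral_inter isPrefixSystem_hPre isPrefixSystem_vPre Φ₁ Φ₂ (fun _ => ⊥) Γ₁ Γ₂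
    (fun _ => ⊤) ⊥ ⊤
  rwa [box_bot_top, plank_bot_top, Set.univ_inter, Set.inter_univ] at this

lemma isIntegral_hPoly : IsIntegral (hPoly Φ₁ Γ₁) := by
  have := isIntegral_hPoly_inter_vPoly (Φ₁ := Φ₁) (Γ₁ := Γ₁) (Φ₂ := fun _ => ⊥) (Γ₂ := fun _ => ⊤)
  rwa [vPoly_eq_prefixPoly, prefixPoly_bot_top, Set.inter_univ] at this

lemma isIntegral_vPoly : IsIntegral (vPoly Φ₂ Γ₂) := by
  have := isIntegral_hPoly_inter_vPoly (Φ₁ := fun _ => ⊥) (Γ₁ := fun _ => ⊤) (Φ₂ := Φ₂) (Γ₂ := Γ₂)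
  rwa [hPoly_eq_prefixPoly, prefixPoly_bot_top, Set.univ_inter] at this

end Matrices
end PrefixBounded

theorem mainTheorem9 (m n : ℕ)
    (Φ₁ : Fin m × Fin n → WithBot ℤ) (Γ₁ : Fin m × Fin n → WithTop ℤ)
    (Φ₂ : Fin m × Fin n → WithBot ℤ) (Γ₂ : Fin m × Fin n → WithTop ℤ)
    (h₁ : ∀ s, PrefixBounded.lo (Φ₁ s) ≤ PrefixBounded.up (Γ₁ s))
    (h₂ : ∀ s, PrefixBounded.lo (Φ₂ s) ≤ PrefixBounded.up (Γ₂ s)) :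
    -- `Q¹` and `Q²` are prefix-bounded g-polymatroids, and they are laminar
    (PrefixBounded.hPoly Φ₁ Γ₁ = PrefixBounded.rowDirectSum
        (fun i => PrefixBounded.elementary (fun j => Φ₁ (i, j)) (fun j => Γ₁ (i, j))) ∧
      PrefixBounded.IsLaminarGPolymatroid (PrefixBounded.hPoly Φ₁ Γ₁)) ∧
    (PrefixBounded.vPoly Φ₂ Γ₂ = PrefixBounded.colDirectSum
        (fun j => PrefixBounded.elementary (fun i => Φ₂ (i, j)) (fun i => Γ₂ (i, j))) ∧
      PrefixBounded.IsLaminarGPolymatroid (PrefixBounded.vPoly Φ₂ Γ₂)) ∧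
    -- the convex hull of the prefix-bounded matrices
    convexHull ℝ (PrefixBounded.toReal '' PrefixBounded.pbm Φ₁ Γ₁ Φ₂ Γ₂) =
      PrefixBounded.hPoly Φ₁ Γ₁ ∩ PrefixBounded.vPoly Φ₂ Γ₂ ∧
    -- the set of prefix-bounded matrices is `M♮₂`-convex
    PrefixBounded.IsM2NaturalConvex (PrefixBounded.pbm Φ₁ Γ₁ Φ₂ Γ₂) ∧
    -- the convex hull with entry bounds and total-sum bounds
    ∀ (f : Fin m × Fin n → WithBot ℤ) (g : Fin m × Fin n → WithTop ℤ)
      (α : WithBot ℤ) (β : WithTop ℤ),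
      (∀ s, PrefixBounded.lo (f s) ≤ PrefixBounded.up (g s)) →
      PrefixBounded.lo α ≤ PrefixBounded.up β →
      convexHull ℝ (PrefixBounded.toReal ''
          (PrefixBounded.pbm Φ₁ Γ₁ Φ₂ Γ₂ ∩ PrefixBounded.bounded f g α β)) =
        (PrefixBounded.hPoly Φ₁ Γ₁ ∩ PrefixBounded.vPoly Φ₂ Γ₂) ∩
          (PrefixBounded.box f g ∩ PrefixBounded.plank α β) := by
  refine ⟨⟨PrefixBounded.hPoly_eq_rowDirectSum Φ₁ Γ₁,
      PrefixBounded.isLaminarGPolymatroid_prefixPoly PrefixBounded.isPrefixSystem_hPre h₁⟩,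
    ⟨PrefixBounded.vPoly_eq_colDirectSum Φ₂ Γ₂,
      PrefixBounded.isLaminarGPolymatroid_prefixPoly PrefixBounded.isPrefixSystem_vPre h₂⟩,
    ?_, ?_, ?_⟩
  · rw [PrefixBounded.pbm_eq]
    exact PrefixBounded.isIntegral_hPoly_inter_vPoly
  · exact ⟨_, _, PrefixBounded.isGPolymatroid_prefixPoly PrefixBounded.isPrefixSystem_hPre h₁,
      PrefixBounded.isIntegral_hPoly,
      PrefixBounded.isGPolymatroid_prefixPoly PrefixBounded.isPrefixSystem_vPre h₂,
      PrefixBounded.isIntegral_vPoly, PrefixBounded.pbm_eq⟩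
  · intro f g α β _ _
    exact PrefixBounded.convexHull_pbm_inter_bounded
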